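/- **Theorem.** Suppose there is some $\varepsilon>0$ such that 4-SUM can be solved in time $O(n^{4/3-\varepsilon})$. Then the 3-uniform hyperclique hypothesis fails. Here: - *Model of computation.* Algorithms are deterministic word RAM programs with unit-cost operations on words of $O(\log n)$ bits, where $n$ is the size parameter of the input. That is, for each algorithm there is a constant $d$ such that on inputs of size $n$ it uses words of $d(\lfloor\log_2 n\rfloor+1)$ bits. Its running time is the number of executed steps in the worst case over all inputs of size $n$. - *4-SUM.* Given four sets $A_1,A_2,A_3,A_4$ of $n$ integers each, decide whether there exist $a_1\in A_1,\dots,a_4\in A_4$ with $a_1+a_2+a_3+a_4=0$. The numbers come from a polynomially sized universe. Accordingly, "4-SUM can be solved in time $O(n^{4/3-\varepsilon})$" means that for every constant $c\in\mathbb N$ there is an algorithm that solves all instances with $A_1,\dots,A_4\subseteq\{-n^c,\dots,n^c\}$ in time $O(n^{4/3-\varepsilon})$; the algorithm and the implied constant may depend on $c$, while $\varepsilon$ does not. - *3-uniform hyperclique hypothesis.* For no integer $k\ge 4$ and no real $\delta>0$ is there an algorithm that decides in time $O(n^{k-\delta})$ whether a given 3-uniform hypergraph on $n$ vertices (given by its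 adjacency tensor) contains a hyperclique on $k$ vertices, i.e. a set $S$ of $k$ vertices such that every 3-element subset of $S$ is a hyperedge. -/

import Mathlib

open Asymptotics Filter

/-! ### A word RAM with a step count -/

namespace WordRAM

/-- Word operations. Comparisons return `1` (true) or `0` (false). -/
inductive Op where
  | add | sub | mul | div | mod | land | lor | xor | shl | shr | eq | lt

/-- Division and remainder follow the conventions of `ℤ` (with `x / 0 = 0`), the bitwise operations
act on two's complement representations, and a shift by a negative amount does nothing. -/
def Op.eval : Op → ℤ → ℤ → ℤ
  | .add, x, y => x + y
  | .sub, x, y => x - y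
  | .mul, x, y => x * y
  | .div, x, y => x / y
  | .mod, x, y => x % y
  | .land, x, y => Int.land x y
  | .lor, x, y => Int.lor x y
  | .xor, x, y => Int.xor x y
  | .shl, x, y => x * 2 ^ y.toNat
  | .shr, x, y => x / 2 ^ y.toNat
  | .eq, x, y => if x = y then 1 else 0
  | .lt, x, y => if x < y then 1 else 0

/-- An operand is a constant of the program or a register. -/
inductive Operand where
  | const (z : ℤ)
  | reg (r : ℕ)

/-- A machine state: registers, and arrays addressed by words. A program names its registers and
arrays explicitly, so it uses only finitely many of them. -/
structure State where
  reg : ℕ → ℤ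
  mem : ℕ → ℤ → ℤ

def Operand.eval (s : State) : Operand → ℤ
  | .const z => z
  | .reg r => s.reg r

/-- The state after writing `z` to register `r`. -/
def State.setReg (s : State) (r : ℕ) (z : ℤ) : State :=
  { s with reg := Function.update s.reg r z }

/-- The state after writing `z` to the cell with address `i` of array `a`. -/
def State.setMem (s : State) (a : ℕ) (i z : ℤ) : State :=
  { s with mem := Function.update s.mem a (Function.update (s.mem a) i z) }

/-- Programs: three-address instructions with indirect addressing, and structured control flow. -/
inductive Prog where
  | skip
  /-- `op r o x y` is `r := x o y`. -/
  | op (r : ℕ) (o : Op) (x y : Operand)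
  /-- `load r a i` is `r := a[i]`. -/
  | load (r a : ℕ) (i : Operand)
  /-- `store a i x` is `a[i] := x`. -/
  | store (a : ℕ) (i x : Operand)
  | seq (p q : Prog)
  /-- `ite x p q` runs `p` if `x ≠ 0` and `q` otherwise. -/
  | ite (x : Operand) (p q : Prog)
  /-- `loop x p` runs `p` as long as `x ≠ 0`. -/
  | loop (x : Operand) (p : Prog)

/-- `z` fits into a signed word of magnitude `w` bits. -/
def Fits (w : ℕ) (z : ℤ) : Prop := |z| < 2 ^ w

/-- `Exec w p s u t`: with `w`-bit words, the program `p` started in state `s` halts in state `u`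
after exactly `t` steps. Each instruction and each test of a condition takes one step. The machine
gets stuck (it does not halt) when it would write, or use as an address, a value that does not fit
into a word. -/
inductive Exec (w : ℕ) : Prog → State → State → ℕ → Prop
  | skip (s : State) : Exec w .skip s s 1
  | op (s : State) (r : ℕ) (o : Op) (x y : Operand)
      (hz : Fits w (o.eval (x.eval s) (y.eval s))) :
      Exec w (.op r o x y) s (s.setReg r (o.eval (x.eval s) (y.eval s))) 1
  | load (s : State) (r a : ℕ) (i : Operand)
      (hi : Fits w (i.eval s)) (hz : Fits w (s.mem a (i.eval s))) :
      Exec w (.load r a i) s (s.setReg r (s.mem a (i.eval s))) 1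
  | store (s : State) (a : ℕ) (i x : Operand)
      (hi : Fits w (i.eval s)) (hz : Fits w (x.eval s)) :
      Exec w (.store a i x) s (s.setMem a (i.eval s) (x.eval s)) 1
  | seq {p q : Prog} {s u v : State} {t₁ t₂ : ℕ}
      (hp : Exec w p s u t₁) (hq : Exec w q u v t₂) : Exec w (.seq p q) s v (t₁ + t₂)
  | ite_true {x : Operand} {p q : Prog} {s u : State} {t : ℕ}
      (hx : x.eval s ≠ 0) (hp : Exec w p s u t) : Exec w (.ite x p q) s u (t + 1)
  | ite_false {x : Operand} {p q : Prog} {s u : State} {t : ℕ}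
      (hx : x.eval s = 0) (hq : Exec w q s u t) : Exec w (.ite x p q) s u (t + 1)
  | loop_stop {x : Operand} {p : Prog} {s : State}
      (hx : x.eval s = 0) : Exec w (.loop x p) s s 1
  | loop_step {x : Operand} {p : Prog} {s u v : State} {t₁ t₂ : ℕ}
      (hx : x.eval s ≠ 0) (hp : Exec w p s u t₁) (hl : Exec w (.loop x p) u v t₂) :
      Exec w (.loop x p) s v (t₁ + t₂ + 1)

/-- A decision problem: instances, their size parameter, their encoding as an initial state of the
machine, and the instances whose answer is yes. -/
structure Problem where
  Instance : Type
  size : Instance → ℕ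
  init : Instance → State
  yes : Instance → Prop

/-- `P` is solvable (deterministically) in time `O(f(n))` on a word RAM with words of `O(log n)`
bits: for some constant `d`, a single program, run with words of `d (⌊log₂ n⌋ + 1)` bits, halts on
every instance of size `n` within `T n = O(f n)` steps and leaves a nonzero value in register `0`
exactly when the answer is yes. -/
def Problem.SolvableInTime (P : Problem) (f : ℕ → ℝ) : Prop :=
  ∃ (p : Prog) (d : ℕ) (T : ℕ → ℕ),
    (fun n => (T n : ℝ)) =O[atTop] f ∧
    ∀ x : P.Instance, ∃ (u : State) (t : ℕ),
      Exec (d * (Nat.log 2 (P.size x) + 1)) p (P.init x) u t ∧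
      t ≤ T (P.size x) ∧
      (u.reg 0 ≠ 0 ↔ P.yes x)

end WordRAM

/-! ### The `k`-SUM problem -/

/-- An instance of `k`-SUM over the universe `{-n^c, …, n^c}`: `k` sets of `n` integers each, the
`i`-th one listed without repetition as `A i 0, …, A i (n - 1)`. -/
structure KSumInstance (k c : ℕ) where
  n : ℕ
  A : Fin k → Fin n → ℤ
  injective : ∀ i, Function.Injective (A i)
  bounded : ∀ i j, |A i j| ≤ (n : ℤ) ^ c

/-- Are there `a₁ ∈ A₁, …, aₖ ∈ Aₖ` with `a₁ + ⋯ + aₖ = 0`? Initially register `0` holds `n`, the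
cells `0, …, n - 1` of array `i` hold the `i`-th set, and everything else is `0`. -/
def kSum (k c : ℕ) : WordRAM.Problem where
  Instance := KSumInstance k c
  size := fun x => x.n
  init := fun x =>
    { reg := fun r => if r = 0 then (x.n : ℤ) else 0
      mem := fun i j =>
        if h : i < k ∧ 0 ≤ j ∧ j.toNat < x.n then x.A ⟨i, h.1⟩ ⟨j.toNat, h.2.2⟩ else 0 }
  yes := fun x => ∃ j : Fin k → Fin x.n, ∑ i, x.A i (j i) = 0

/-! ### The 3-uniform hyperclique hypothesis -/

/-- A `3`-uniform hypergraph on the vertex set `{0, …, n - 1}`, given by its hyperedges. -/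
structure ThreeUniformHypergraph where
  n : ℕ
  edges : Finset (Finset (Fin n))
  uniform : ∀ e ∈ edges, e.card = 3

/-- A hyperclique: every `3`-element subset of `S` is a hyperedge. -/
def ThreeUniformHypergraph.IsHyperclique (H : ThreeUniformHypergraph) (S : Finset (Fin H.n)) :
    Prop :=
  ∀ e : Finset (Fin H.n), e ⊆ S → e.card = 3 → e ∈ H.edges

open Classical in
/-- Is there a hyperclique with `k` vertices? The size parameter is the number `n` of vertices.
Initially register `0` holds `n`, array `0` holds the adjacency tensor (cell `(x n + y) n + z`
is `1` if `{x, y, z}` is a hyperedge, and `0` otherwise), and everything else is `0`. -/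
noncomputable def hypercliqueDetection (k : ℕ) : WordRAM.Problem where
  Instance := ThreeUniformHypergraph
  size := fun H => H.n
  init := fun H =>
    { reg := fun r => if r = 0 then (H.n : ℤ) else 0
      mem := fun a i =>
        if a = 0 ∧ ∃ x y z : Fin H.n,
            i = ((x : ℤ) * H.n + y) * H.n + z ∧ ({x, y, z} : Finset (Fin H.n)) ∈ H.edges
        then 1 else 0 }
  yes := fun H => ∃ S : Finset (Fin H.n), S.card = k ∧ H.IsHyperclique S

/-- For no `k ≥ 4` and `δ > 0` can one decide in time `O(n^(k - δ))` whether a `3`-uniform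
hypergraph with `n` vertices contains a hyperclique with `k` vertices. -/
def ThreeUniformHypercliqueHypothesis : Prop :=
  ∀ k : ℕ, 4 ≤ k → ∀ δ : ℝ, 0 < δ →
    ¬ (hypercliqueDetection k).SolvableInTime (fun n => (n : ℝ) ^ ((k : ℝ) - δ))

/-! The case `k = 4` of the hypothesis is refuted. Look for vertices v₀, …, v₃ whose four triples
are hyperedges, and let the a-th set hold one number for every candidate (x, y, z) for (v_{a+1},
v_{a+2}, v_{a+3}), indices mod 4. The three sets other than the i-th each guess v_i, and a vanishing
sum must force the three guesses to agree.

A single linear equation achieves this. The map f(x) = x² + n³x (`apFree`) has an image free of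
three-term progressions, so f(x) + f(y) - 2f(z) = 0 implies x = y = z (`apFree_eq`). Each v_i gets
its own digit in base n⁵, with coefficients 1, 1, -2 in the three sets. The unit digit is 1 exactly
for triples that are not hyperedges. All digits of a sum of four numbers stay below n⁵ in absolute
value, so the sum vanishes only if every digit does (`digits_eq_zero`, `eq_of_sum_value_eq_zero`).

This gives N = n³ numbers per set, of size polynomial in n, written by a program in O(n³) steps
(`exec_reduce`). Since N^(4/3-ε) = n^(4-3ε), a fast 4-SUM algorithm finds hypercliques in time
O(n^(4-δ)) with δ = min(1, 3ε). The word RAM part compiles arithmetic expressions and bounds all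
intermediate values by a fixed power of n. -/

namespace WordRAM

/-! ### Word RAM: longer words, compiled expressions, cleared registers -/

lemma Fits.mono {w w' : ℕ} (h : w ≤ w') {z : ℤ} (hz : Fits w z) : Fits w' z :=
  lt_of_lt_of_le hz (pow_le_pow_right₀ (by norm_num) h)

/-- An execution remains valid with longer words. -/
lemma Exec.mono {w w' : ℕ} (h : w ≤ w') {p : Prog} {s u : State} {t : ℕ} (he : Exec w p s u t) :
    Exec w' p s u t := by
  induction he with
  | skip s => exact .skip s
  | op s r o x y hz => exact .op s r o x y (hz.mono h)
  | load s r a i hi hz => exact .load s r a i (hi.mono h) (hz.mono h)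
  | store s a i x hi hz => exact .store s a i x (hi.mono h) (hz.mono h)
  | seq _ _ h1 h2 => exact .seq h1 h2
  | ite_true hx _ h1 => exact .ite_true hx h1
  | ite_false hx _ h1 => exact .ite_false hx h1
  | loop_stop hx => exact Exec.loop_stop hx
  | loop_step hx _ _ h1 h2 => exact .loop_step hx h1 h2

lemma Exec.cast_time {w : ℕ} {p : Prog} {s u : State} {t t' : ℕ} (h : Exec w p s u t)
    (ht : t = t') : Exec w p s u t' := ht ▸ h

/-- Arithmetic expressions over registers. -/
inductive Expr where
  | const (z : ℤ)
  | reg (r : ℕ)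
  | bin (o : Op) (a b : Expr)

namespace Expr

def eval (ρ : ℕ → ℤ) : Expr → ℤ
  | .const z => z
  | .reg r => ρ r
  | .bin o a b => o.eval (a.eval ρ) (b.eval ρ)

/-- Every intermediate value fits into a word. -/
def Ok (w : ℕ) (ρ : ℕ → ℤ) : Expr → Prop
  | .const z => Fits w z
  | .reg r => Fits w (ρ r)
  | .bin o a b => a.Ok w ρ ∧ b.Ok w ρ ∧ Fits w (o.eval (a.eval ρ) (b.eval ρ))

/-- The expression reads only registers below `k` and uses only `+`, `-`, `*`, `/`, `%`. -/
def Simple (k : ℕ) : Expr → Prop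
  | .const _ => True
  | .reg r => r < k
  | .bin o a b => a.Simple k ∧ b.Simple k ∧ (o = .add ∨ o = .sub ∨ o = .mul ∨ o = .div ∨ o = .mod)

def size : Expr → ℕ
  | .const _ => 1
  | .reg _ => 1
  | .bin _ a b => a.size + b.size + 1

/-- Code that evaluates the expression into register `r`, with the registers above as scratch. -/
def compile (r : ℕ) : Expr → Prog
  | .const z => .op r .add (.const z) (.const 0)
  | .reg q => .op r .add (.reg q) (.const 0)
  | .bin o a b =>
      .seq (a.compile r) (.seq (b.compile (r + 1)) (.op r o (.reg r) (.reg (r + 1))))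

/-- An exponent bounding the values of the expression by a power of the size parameter. -/
def deg (m : ℕ) : Expr → ℕ
  | .const z => z.natAbs
  | .reg _ => m
  | .bin _ a b => a.deg m + b.deg m + 1

lemma eval_congr {k : ℕ} {ρ σ : ℕ → ℤ} (h : ∀ q < k, ρ q = σ q) :
    ∀ e : Expr, e.Simple k → e.eval ρ = e.eval σ
  | .const _, _ => rfl
  | .reg r, hr => h r hr
  | .bin o a b, ⟨ha, hb, _⟩ => by simp only [eval, eval_congr h a ha, eval_congr h b hb]

lemma ok_congr {w k : ℕ} {ρ σ : ℕ → ℤ} (h : ∀ q < k, ρ q = σ q) :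
    ∀ e : Expr, e.Simple k → e.Ok w ρ → e.Ok w σ
  | .const _, _, hw => hw
  | .reg r, hr, hw => by simpa only [Ok, h r hr] using hw
  | .bin o a b, ⟨ha, hb, _⟩, ⟨wa, wb, wo⟩ =>
      ⟨ok_congr h a ha wa, ok_congr h b hb wb,
        by rwa [← eval_congr h a ha, ← eval_congr h b hb]⟩

/-- The registers from `r` on act as a stack: the left value rests in `r` while the right operand is
computed above it. The inputs lie below `k ≤ r`, so both operands see the same inputs. -/
lemma exec_compile {w k : ℕ} : ∀ (e : Expr) (r : ℕ) (s : State), k ≤ r → e.Simple k →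
    e.Ok w s.reg → ∃ u, Exec w (e.compile r) s u e.size ∧ u.mem = s.mem ∧
      u.reg r = e.eval s.reg ∧ (∀ q < r, u.reg q = s.reg q) ∧
      ∀ q, r + e.size ≤ q → u.reg q = s.reg q
  | .const z, r, s, _, _, hw => by
      refine ⟨_, .op s r .add _ _ (by simpa [Op.eval, Operand.eval, Ok] using hw), rfl, ?_, ?_, ?_⟩
      · simp [State.setReg, Op.eval, Operand.eval, eval]
      · intro q hq; simp [State.setReg, hq.ne]
      · intro q hq; simp only [size] at hq
        simp [State.setReg, show q ≠ r by omega]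
  | .reg q, r, s, _, _, hw => by
      refine ⟨_, .op s r .add _ _ (by simpa [Op.eval, Operand.eval, Ok] using hw), rfl, ?_, ?_, ?_⟩
      · simp [State.setReg, Op.eval, Operand.eval, eval]
      · intro q hq; simp [State.setReg, hq.ne]
      · intro q hq; simp only [size] at hq
        simp [State.setReg, show q ≠ r by omega]
  | .bin o a b, r, s, hr, ⟨ha, hb, _⟩, ⟨wa, wb, wo⟩ => by
      obtain ⟨u, hu, um, ur, ul, ug⟩ := exec_compile a r s hr ha wa
      have hsu : ∀ q < k, s.reg q = u.reg q := fun q hq => (ul q (by omega)).symm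
      obtain ⟨v, hv, vm, vr, vl, vg⟩ :=
        exec_compile b (r + 1) u (by omega) hb (ok_congr hsu b hb wb)
      have e1 : v.reg r = a.eval s.reg := by rw [vl r (by omega), ur]
      have e2 : v.reg (r + 1) = b.eval s.reg := by rw [vr, eval_congr hsu b hb]
      have hop := Exec.op (w := w) v r o (.reg r) (.reg (r + 1))
        (by simpa only [Operand.eval, e1, e2] using wo)
      refine ⟨_, (hu.seq (hv.seq hop)).cast_time (by simp only [size]; omega), ?_, ?_, ?_, ?_⟩
      · simp [State.setReg, vm, um]
      · simp [State.setReg, Operand.eval, e1, e2, eval]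
      · intro q hq
        simp [State.setReg, hq.ne, vl q (by omega), ul q hq]
      · intro q hq
        simp only [size] at hq
        simp [State.setReg, show q ≠ r by omega, vg q (by omega), ug q (by omega)]

/-- For `A, B ≥ 1` and `n ≥ 2`, each of `A + B`, `A * B`, `A` and `B` is at most `A * B * n`. This
covers the five permitted operations and explains the `+ 1` in `deg`. -/
lemma abs_eval_le {n : ℤ} (hn : 2 ≤ n) {m k : ℕ} {ρ : ℕ → ℤ} (h : ∀ q < k, |ρ q| ≤ n ^ m) :
    ∀ e : Expr, e.Simple k → |e.eval ρ| ≤ n ^ e.deg m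
  | .const z, _ => by
      simp only [eval, deg, Int.abs_eq_natAbs]
      calc (z.natAbs : ℤ) ≤ 2 ^ z.natAbs := by exact_mod_cast Nat.lt_two_pow_self.le
        _ ≤ n ^ z.natAbs := pow_le_pow_left₀ (by norm_num) hn _
  | .reg r, hr => h r hr
  | .bin o a b, ⟨ha, hb, ho⟩ => by
      have h1 := abs_eval_le hn h a ha
      have h2 := abs_eval_le hn h b hb
      simp only [eval, deg]
      generalize a.eval ρ = x at *
      generalize b.eval ρ = y at *
      have p1 : 1 ≤ n ^ a.deg m := one_le_pow₀ (by omega)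
      have p2 : 1 ≤ n ^ b.deg m := one_le_pow₀ (by omega)
      rw [pow_succ, pow_add]
      generalize n ^ a.deg m = A at *
      generalize n ^ b.deg m = B at *
      have hAB : 1 ≤ A * B := by nlinarith
      have hs : A + B ≤ A * B * n := by nlinarith
      have hA : A ≤ A * B * n := by omega
      have hB : B ≤ A * B * n := by omega
      rcases ho with rfl | rfl | rfl | rfl | rfl <;> simp only [Op.eval]
      · exact (abs_add_le x y).trans (by omega)
      · exact (abs_sub x y).trans (by omega)
      · rw [abs_mul]
        calc |x| * |y| ≤ A * B := mul_le_mul h1 h2 (abs_nonneg _) (by omega)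
          _ ≤ A * B * n := by nlinarith
      · have : |x / y| ≤ |x| := Int.abs_ediv_le_abs x y
        omega
      · by_cases hy : y = 0
        · subst hy; rw [Int.emod_zero]; omega
        · have h3 := Int.emod_nonneg x hy
          have h4 := Int.emod_lt_abs x hy
          rw [abs_of_nonneg h3]; omega

lemma ok_of_simple {n : ℤ} (hn : 2 ≤ n) {m k w K : ℕ} {ρ : ℕ → ℤ} (h : ∀ q < k, |ρ q| ≤ n ^ m)
    (hw : ∀ z : ℤ, |z| ≤ n ^ K → Fits w z) :
    ∀ e : Expr, e.Simple k → e.deg m ≤ K → e.Ok w ρ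
  | .const z, he, hK => hw _ ((abs_eval_le hn h (.const z) he).trans
      (pow_le_pow_right₀ (by omega) hK))
  | .reg r, he, hK => hw _ ((abs_eval_le hn h (.reg r) he).trans
      (pow_le_pow_right₀ (by omega) hK))
  | .bin o a b, he, hK => by
      have h3 := hw _ ((abs_eval_le hn h (.bin o a b) he).trans
        (pow_le_pow_right₀ (by omega) hK))
      simp only [deg] at hK
      exact ⟨ok_of_simple hn h hw a he.1 (by omega), ok_of_simple hn h hw b he.2.1 (by omega), h3⟩

end Expr

/-- Set the registers `1, …, k` to `0`. -/
def clear : ℕ → Prog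
  | 0 => .skip
  | k + 1 => .seq (clear k) (.op (k + 1) .add (.const 0) (.const 0))

lemma exec_clear (w : ℕ) (s : State) : ∀ k : ℕ, ∃ u, Exec w (clear k) s u (k + 1) ∧
    u.mem = s.mem ∧ u.reg 0 = s.reg 0 ∧ (∀ q, 1 ≤ q → q ≤ k → u.reg q = 0) ∧
    ∀ q, k < q → u.reg q = s.reg q
  | 0 => ⟨s, .skip s, rfl, rfl, fun q h1 h2 => by omega, fun _ _ => rfl⟩
  | k + 1 => by
      obtain ⟨u, hu, um, u0, ul, ug⟩ := exec_clear w s k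
      refine ⟨_, hu.seq (.op u (k + 1) .add _ _ (by simp [Fits, Op.eval, Operand.eval])), um,
        ?_, ?_, ?_⟩
      · simp [State.setReg, u0]
      · intro q h1 h2
        by_cases hq : q = k + 1
        · subst hq; simp [State.setReg, Op.eval, Operand.eval]
        · simp [State.setReg, hq, ul q h1 (by omega)]
      · intro q hq
        simp [State.setReg, show q ≠ k + 1 by omega, ug q (by omega)]

end WordRAM

/-! ### Base-M digits and a progression-free embedding -/

/-- If the digits in base `M` are smaller than `M` in absolute value, then only the zero digits
represent `0`. -/
lemma digits_eq_zero {M d₀ d₁ d₂ d₃ d₄ : ℤ} (h₀ : |d₀| < M) (h₁ : |d₁| < M) (h₂ : |d₂| < M)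
    (h₃ : |d₃| < M) (h₄ : |d₄| < M)
    (h : d₀ + d₁ * M + d₂ * M ^ 2 + d₃ * M ^ 3 + d₄ * M ^ 4 = 0) :
    d₀ = 0 ∧ d₁ = 0 ∧ d₂ = 0 ∧ d₃ = 0 ∧ d₄ = 0 := by
  have hM : M ≠ 0 := by rintro rfl; exact absurd (abs_nonneg d₀) (by omega)
  -- The lowest digit is a multiple of `M` smaller than `M`, hence zero; cancelling `M` leaves the
  -- same situation with one digit fewer.
  have key : ∀ d q : ℤ, |d| < M → d + q * M = 0 → d = 0 ∧ q = 0 := by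
    intro d q hd hq
    have h0 : d = 0 := Int.eq_zero_of_abs_lt_dvd ⟨-q, by linarith⟩ hd
    subst h0
    exact ⟨rfl, by simpa [hM] using hq⟩
  obtain ⟨r₀, h⟩ := key d₀ (d₁ + (d₂ + (d₃ + d₄ * M) * M) * M) h₀ (by rw [← h]; ring)
  obtain ⟨r₁, h⟩ := key _ _ h₁ h
  obtain ⟨r₂, h⟩ := key _ _ h₂ h
  obtain ⟨r₃, h⟩ := key _ _ h₃ h
  exact ⟨r₀, r₁, r₂, r₃, h⟩

/-- An embedding of `{0, …, n - 1}` into the integers whose image has no nontrivial three-term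
arithmetic progression. -/
def apFree (n x : ℤ) : ℤ := x * (x + n ^ 3)

lemma apFree_nonneg {n x : ℤ} (h0 : 0 ≤ x) (hx : x < n) : 0 ≤ apFree n x := by
  have : 0 ≤ n ^ 3 := pow_nonneg (by omega) _
  unfold apFree; positivity

lemma apFree_lt {n x : ℤ} (hn : 2 ≤ n) (h0 : 0 ≤ x) (hx : x < n) : apFree n x < n ^ 4 := by
  unfold apFree
  have h1 : n ^ 3 = n * n ^ 2 := by ring
  have h3 : 0 < n ^ 2 := by positivity
  have : x * (x + n ^ 3) ≤ (n - 1) * (n - 1 + n ^ 3) := by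
    apply mul_le_mul <;> first | omega | positivity
  nlinarith

/-- In base `n ^ 3` the equation splits into u + v = 2w and u² + v² = 2w². Together they give 2(u -
w)² = 0, which is the strict convexity of the square. -/
lemma apFree_eq {n u v w : ℤ} (hn : 2 ≤ n) (hu : 0 ≤ u) (hu' : u < n) (hv : 0 ≤ v) (hv' : v < n)
    (hw : 0 ≤ w) (hw' : w < n) (h : apFree n u + apFree n v - 2 * apFree n w = 0) :
    u = w ∧ v = w := by
  unfold apFree at h
  have h3 : 2 * n ^ 2 ≤ n ^ 3 := by
    rw [pow_succ n 2]; nlinarith [sq_nonneg n]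
  have e : (u ^ 2 + v ^ 2 - 2 * w ^ 2) + (u + v - 2 * w) * n ^ 3 = 0 := by rw [← h]; ring
  have hb : |u ^ 2 + v ^ 2 - 2 * w ^ 2| < n ^ 3 := by
    have a1 : u ^ 2 < n ^ 2 := pow_lt_pow_left₀ hu' hu (by norm_num)
    have a2 : v ^ 2 < n ^ 2 := pow_lt_pow_left₀ hv' hv (by norm_num)
    have a3 : w ^ 2 < n ^ 2 := pow_lt_pow_left₀ hw' hw (by norm_num)
    rw [abs_lt]
    constructor <;> nlinarith [sq_nonneg u, sq_nonneg v, sq_nonneg w]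
  have h0 : u ^ 2 + v ^ 2 - 2 * w ^ 2 = 0 :=
    Int.eq_zero_of_abs_lt_dvd ⟨-(u + v - 2 * w), by linarith⟩ hb
  have hpos : n ^ 3 ≠ 0 := by positivity
  have h1 : u + v - 2 * w = 0 := by
    rw [h0, zero_add] at e
    exact (mul_eq_zero.1 e).resolve_right hpos
  have h2 : (u - w) ^ 2 = 0 := by
    have : v = 2 * w - u := by linarith
    subst this; nlinarith
  have := pow_eq_zero_iff (n := 2) (by norm_num) |>.1 h2
  omega

lemma apFree_injective {n u v : ℤ} (hn : 2 ≤ n) (hu : 0 ≤ u) (hu' : u < n) (hv : 0 ≤ v)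
    (hv' : v < n) (h : apFree n u = apFree n v) : u = v :=
  (apFree_eq hn hu hu' hu hu' hv hv' (by rw [h]; ring)).1

/-! ### The numbers attached to triples -/

namespace HypercliqueToKSum

open WordRAM

/-- The exponent of the place of the `i`-th vertex in the `a`-th set, for `i = 1, 2, 3`. -/
def place (a i : ℕ) : ℕ := (a + i) % 4 + 1

/-- The element of the `a`-th set that belongs to the triple `(x, y, z)`. -/
def value (n : ℤ) (a : ℕ) (x y z b : ℤ) : ℤ :=
  (1 - b) + apFree n x * (n ^ 5) ^ place a 1 + apFree n y * (n ^ 5) ^ place a 2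
    - 2 * apFree n z * (n ^ 5) ^ place a 3

/-- The position of the triple `(x, y, z)` in the adjacency tensor. -/
def position (n x y z : ℤ) : ℤ := (x * n + y) * n + z

lemma two_mul_pow_four_le {n : ℤ} (hn : 2 ≤ n) : 2 * n ^ 4 ≤ n ^ 5 := by
  have : 0 < n ^ 4 := by positivity
  rw [pow_succ n 4]; nlinarith

lemma thirty_two_le {n : ℤ} (hn : 2 ≤ n) : 32 ≤ n ^ 5 :=
  calc (32 : ℤ) = 2 ^ 5 := by norm_num
    _ ≤ n ^ 5 := pow_le_pow_left₀ (by norm_num) hn _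

/-- Needed because a 4-SUM instance lists its sets without repetition. The digits of the difference
of two numbers are small, so equal numbers have equal digits, and `apFree` is injective. -/
lemma value_injective {n : ℤ} (hn : 2 ≤ n) {a : ℕ} (ha : a < 4) {x y z b x' y' z' b' : ℤ}
    (hx : 0 ≤ x ∧ x < n) (hy : 0 ≤ y ∧ y < n) (hz : 0 ≤ z ∧ z < n)
    (hx' : 0 ≤ x' ∧ x' < n) (hy' : 0 ≤ y' ∧ y' < n) (hz' : 0 ≤ z' ∧ z' < n)
    (hb : b = 0 ∨ b = 1) (hb' : b' = 0 ∨ b' = 1)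
    (h : value n a x y z b = value n a x' y' z' b') : x = x' ∧ y = y' ∧ z = z' := by
  have hM := two_mul_pow_four_le hn
  have hM' := thirty_two_le hn
  have bx := apFree_lt hn hx.1 hx.2
  have bx' := apFree_lt hn hx'.1 hx'.2
  have by_ := apFree_lt hn hy.1 hy.2
  have by' := apFree_lt hn hy'.1 hy'.2
  have bz := apFree_lt hn hz.1 hz.2
  have bz' := apFree_lt hn hz'.1 hz'.2
  have cx := apFree_nonneg hx.1 hx.2
  have cx' := apFree_nonneg hx'.1 hx'.2
  have cy := apFree_nonneg hy.1 hy.2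
  have cy' := apFree_nonneg hy'.1 hy'.2
  have cz := apFree_nonneg hz.1 hz.2
  have cz' := apFree_nonneg hz'.1 hz'.2
  have d0 : |b' - b| < n ^ 5 := by rw [abs_lt]; omega
  have d1 : |apFree n x - apFree n x'| < n ^ 5 := by rw [abs_lt]; omega
  have d2 : |apFree n y - apFree n y'| < n ^ 5 := by rw [abs_lt]; omega
  have d3 : |-(2 * (apFree n z - apFree n z'))| < n ^ 5 := by rw [abs_lt]; omega
  -- The `a`-th set leaves the place of the vertex `a` empty; this is its digit.
  have dz : |(0 : ℤ)| < n ^ 5 := by rw [abs_zero]; omega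
  suffices hs : apFree n x - apFree n x' = 0 ∧ apFree n y - apFree n y' = 0 ∧
      -(2 * (apFree n z - apFree n z')) = 0 by
    obtain ⟨h1, h2, h3⟩ := hs
    exact ⟨apFree_injective hn hx.1 hx.2 hx'.1 hx'.2 (by omega),
      apFree_injective hn hy.1 hy.2 hy'.1 hy'.2 (by omega),
      apFree_injective hn hz.1 hz.2 hz'.1 hz'.2 (by omega)⟩
  unfold value at h
  generalize n ^ 5 = M at *
  generalize apFree n x = X at *
  generalize apFree n y = Y at *
  generalize apFree n z = Z at *
  generalize apFree n x' = X' at *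
  generalize apFree n y' = Y' at *
  generalize apFree n z' = Z' at *
  interval_cases a <;> norm_num [place] at h
  · obtain ⟨-, -, h1, h2, h3⟩ := digits_eq_zero d0 dz d1 d2 d3 (by linarith)
    exact ⟨h1, h2, h3⟩
  · obtain ⟨-, h3, -, h1, h2⟩ := digits_eq_zero d0 d3 dz d1 d2 (by linarith)
    exact ⟨h1, h2, h3⟩
  · obtain ⟨-, h2, h3, -, h1⟩ := digits_eq_zero d0 d2 d3 dz d1 (by linarith)
    exact ⟨h1, h2, h3⟩
  · obtain ⟨-, h1, h2, h3, -⟩ := digits_eq_zero d0 d1 d2 d3 dz (by linarith)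
    exact ⟨h1, h2, h3⟩

/-- Four elements sum to zero only if they come from hyperedges that agree on the vertices. -/
lemma eq_of_sum_value_eq_zero {n : ℤ} (hn : 2 ≤ n) {x y z b : ℕ → ℤ}
    (hx : ∀ i, 0 ≤ x i ∧ x i < n) (hy : ∀ i, 0 ≤ y i ∧ y i < n) (hz : ∀ i, 0 ≤ z i ∧ z i < n)
    (hb : ∀ i, b i = 0 ∨ b i = 1)
    (h : value n 0 (x 0) (y 0) (z 0) (b 0) + value n 1 (x 1) (y 1) (z 1) (b 1) +
      value n 2 (x 2) (y 2) (z 2) (b 2) + value n 3 (x 3) (y 3) (z 3) (b 3) = 0) :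
    (b 0 = 1 ∧ b 1 = 1 ∧ b 2 = 1 ∧ b 3 = 1) ∧ (x 3 = z 1 ∧ y 2 = z 1) ∧
      (x 0 = z 2 ∧ y 3 = z 2) ∧ (x 1 = z 3 ∧ y 0 = z 3) ∧ (x 2 = z 0 ∧ y 1 = z 0) := by
  have hM := two_mul_pow_four_le hn
  have hM' := thirty_two_le hn
  have key : ∀ i j k, |apFree n (x i) + apFree n (y j) - 2 * apFree n (z k)| < n ^ 5 := by
    intro i j k
    have b1 := apFree_lt hn (hx i).1 (hx i).2
    have b2 := apFree_lt hn (hy j).1 (hy j).2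
    have b3 := apFree_lt hn (hz k).1 (hz k).2
    have c1 := apFree_nonneg (hx i).1 (hx i).2
    have c2 := apFree_nonneg (hy j).1 (hy j).2
    have c3 := apFree_nonneg (hz k).1 (hz k).2
    rw [abs_lt]; omega
  have h0 := hb 0
  have h1 := hb 1
  have h2 := hb 2
  have h3 := hb 3
  -- The unit digit counts the chosen triples that are not hyperedges, so there is no carry.
  have d0 : |4 - b 0 - b 1 - b 2 - b 3| < n ^ 5 := by rw [abs_lt]; omega
  norm_num [value, place] at h
  -- Place `i + 1` collects the three guesses for the vertex `i`: `x` from set `i - 1`, `y` from set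
  -- `i - 2` and `z` from set `i - 3`, modulo 4.
  obtain ⟨e0, e1, e2, e3, e4⟩ := digits_eq_zero d0 (key 3 2 1) (key 0 3 2) (key 1 0 3) (key 2 1 0)
    (by linarith)
  have fin : ∀ i j k, apFree n (x i) + apFree n (y j) - 2 * apFree n (z k) = 0 →
      x i = z k ∧ y j = z k := fun i j k =>
    apFree_eq hn (hx i).1 (hx i).2 (hy j).1 (hy j).2 (hz k).1 (hz k).2
  exact ⟨by omega, fin _ _ _ e1, fin _ _ _ e2, fin _ _ _ e3, fin _ _ _ e4⟩

/-- Every vertex occurs in three of the four numbers, at the same place, with coefficients 1, 1 and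
-2. -/
lemma sum_value_eq_zero (n : ℤ) (v : ℕ → ℤ) :
    value n 0 (v 1) (v 2) (v 3) 1 + value n 1 (v 2) (v 3) (v 0) 1 +
      value n 2 (v 3) (v 0) (v 1) 1 + value n 3 (v 0) (v 1) (v 2) 1 = 0 := by
  norm_num [value, place]
  ring

lemma position_div {n x y z : ℤ} (hy : 0 ≤ y ∧ y < n) (hz : 0 ≤ z ∧ z < n) :
    position n x y z / (n * n) = x := by
  have hn : 0 < n := by omega
  rw [← Int.ediv_ediv_of_nonneg hn.le, position, add_comm (_ * n) z,
    Int.add_mul_ediv_right _ _ hn.ne', Int.ediv_eq_zero_of_lt hz.1 hz.2, zero_add,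
    add_comm (_ * n) y, Int.add_mul_ediv_right _ _ hn.ne', Int.ediv_eq_zero_of_lt hy.1 hy.2,
    zero_add]

lemma position_div_mod {n x y z : ℤ} (hy : 0 ≤ y ∧ y < n) (hz : 0 ≤ z ∧ z < n) :
    position n x y z / n % n = y := by
  have hn : 0 < n := by omega
  rw [position, add_comm (_ * n) z,
    Int.add_mul_ediv_right _ _ hn.ne', Int.ediv_eq_zero_of_lt hz.1 hz.2, zero_add,
    add_comm (_ * n) y, Int.add_mul_emod_self_right, Int.emod_eq_of_lt hy.1 hy.2]

lemma position_mod {n x y z : ℤ} (hz : 0 ≤ z ∧ z < n) : position n x y z % n = z := by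
  rw [position, add_comm (_ * n) z, Int.add_mul_emod_self_right, Int.emod_eq_of_lt hz.1 hz.2]

lemma exists_position {n : ℕ} {j : ℤ} (h0 : 0 ≤ j) (hj : j < (n : ℤ) ^ 3) :
    ∃ x y z : Fin n, j = position n x y z := by
  have hn : 0 < (n : ℤ) := by
    rcases Nat.eq_zero_or_pos n with rfl | h
    · simp at hj; omega
    · exact_mod_cast h
  have hx0 : 0 ≤ j / n / n := Int.ediv_nonneg (Int.ediv_nonneg h0 hn.le) hn.le
  have hx : j / n / n < n :=
    Int.ediv_lt_of_lt_mul hn (Int.ediv_lt_of_lt_mul hn (by linarith [pow_succ (n : ℤ) 2, sq (n:ℤ)]))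
  have hy0 : 0 ≤ j / n % n := Int.emod_nonneg _ hn.ne'
  have hy : j / n % n < n := Int.emod_lt_of_pos _ hn
  have hz0 : 0 ≤ j % n := Int.emod_nonneg _ hn.ne'
  have hz : j % n < n := Int.emod_lt_of_pos _ hn
  refine ⟨⟨(j / n / n).toNat, by omega⟩, ⟨(j / n % n).toNat, by omega⟩,
    ⟨(j % n).toNat, by omega⟩, ?_⟩
  simp only [Int.toNat_of_nonneg hx0, Int.toNat_of_nonneg hy0, Int.toNat_of_nonneg hz0, position]
  have e1 := Int.ediv_mul_add_emod (j / n) n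
  have e2 := Int.ediv_mul_add_emod j n
  rw [e1, e2]

lemma position_bounds {n : ℕ} (x y z : Fin n) :
    0 ≤ position n x y z ∧ position n x y z < (n : ℤ) ^ 3 := by
  have hx : ((x : ℕ) : ℤ) + 1 ≤ n := by exact_mod_cast x.2
  have hy : ((y : ℕ) : ℤ) + 1 ≤ n := by exact_mod_cast y.2
  have hz : ((z : ℕ) : ℤ) + 1 ≤ n := by exact_mod_cast z.2
  have h0 : (0 : ℤ) ≤ n := by positivity
  unfold position
  refine ⟨by positivity, ?_⟩
  have h1 : ((x : ℕ) : ℤ) * n + y + 1 ≤ (n : ℤ) * n := by nlinarith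
  nlinarith

/-! ### The numbers as compilable expressions -/

open Expr in
/-- The expression for `n ^ k`. -/
def powExpr : ℕ → Expr
  | 0 => const 1
  | k + 1 => bin .mul (powExpr k) (reg 0)

/-- The expression for `apFree n e`. -/
def apFreeExpr (e : Expr) : Expr := .bin .mul e (.bin .add e (powExpr 3))

open Expr in
/-- The expression for the entry at position `j` of the `a`-th set, where registers `0`, `1` and `2`
hold `n`, `j` and the entry of the adjacency tensor at `j`. -/
def entryExpr (a : ℕ) : Expr :=
  bin .sub
    (bin .add
      (bin .add (bin .sub (const 1) (reg 2))
        (bin .mul (apFreeExpr (bin .div (reg 1) (bin .mul (reg 0) (reg 0))))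
          (powExpr (5 * place a 1))))
      (bin .mul (apFreeExpr (bin .mod (bin .div (reg 1) (reg 0)) (reg 0)))
        (powExpr (5 * place a 2))))
    (bin .mul (bin .mul (const 2) (apFreeExpr (bin .mod (reg 1) (reg 0))))
      (powExpr (5 * place a 3)))

lemma eval_powExpr (ρ : ℕ → ℤ) : ∀ k, (powExpr k).eval ρ = ρ 0 ^ k
  | 0 => by simp [powExpr, Expr.eval]
  | k + 1 => by simp [powExpr, Expr.eval, Op.eval, eval_powExpr ρ k, pow_succ]

lemma simple_powExpr : ∀ k, (powExpr k).Simple 3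
  | 0 => trivial
  | k + 1 => ⟨simple_powExpr k, by simp [Expr.Simple], by simp⟩

lemma simple_entryExpr (a : ℕ) : (entryExpr a).Simple 3 := by
  simp [entryExpr, apFreeExpr, Expr.Simple, simple_powExpr]

lemma eval_entryExpr (ρ : ℕ → ℤ) (a : ℕ) :
    (entryExpr a).eval ρ = value (ρ 0) a (ρ 1 / (ρ 0 * ρ 0)) (ρ 1 / ρ 0 % ρ 0) (ρ 1 % ρ 0)
      (ρ 2) := by
  simp [entryExpr, apFreeExpr, Expr.eval, Op.eval, eval_powExpr, value, apFree, pow_mul]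

end HypercliqueToKSum

/-! ### The 4-SUM instance and its correctness -/

namespace HypercliqueToKSum

open WordRAM

/-- The entry of the adjacency tensor at position `j`. -/
noncomputable def tensor (H : ThreeUniformHypergraph) (j : ℤ) : ℤ :=
  ((hypercliqueDetection 4).init H).mem 0 j

lemma tensor_eq_zero_or_one (H : ThreeUniformHypergraph) (j : ℤ) :
    tensor H j = 0 ∨ tensor H j = 1 := by
  simp only [tensor, hypercliqueDetection]
  split_ifs <;> simp

lemma fin_bounds {n : ℕ} (x : Fin n) : 0 ≤ ((x : ℕ) : ℤ) ∧ ((x : ℕ) : ℤ) < n :=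
  ⟨by positivity, by exact_mod_cast x.2⟩

/-- The base-`n` digits of a position determine the triple, so the existential in the encoding has
only this witness. -/
lemma tensor_position (H : ThreeUniformHypergraph) (x y z : Fin H.n) :
    tensor H (position H.n x y z) = 1 ↔ ({x, y, z} : Finset (Fin H.n)) ∈ H.edges := by
  simp only [tensor, hypercliqueDetection]
  rw [ite_eq_left_iff]
  constructor
  · intro h
    have h1 := not_imp_comm.1 h (by norm_num)
    obtain ⟨-, x', y', z', hj, he⟩ := h1
    change position H.n x y z = position H.n x' y' z' at hj
    have hx := position_div (n := H.n) (x := x) (fin_bounds y) (fin_bounds z)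
    have hy := position_div_mod (n := H.n) (x := x) (fin_bounds y) (fin_bounds z)
    have hz := position_mod (n := H.n) (x := x) (y := y) (fin_bounds z)
    rw [hj, position_div (fin_bounds y') (fin_bounds z')] at hx
    rw [hj, position_div_mod (fin_bounds y') (fin_bounds z')] at hy
    rw [hj, position_mod (fin_bounds z')] at hz
    obtain rfl : x' = x := Fin.ext (by exact_mod_cast hx)
    obtain rfl : y' = y := Fin.ext (by exact_mod_cast hy)
    obtain rfl : z' = z := Fin.ext (by exact_mod_cast hz)
    exact he
  · intro he h
    exact absurd ⟨trivial, x, y, z, rfl, he⟩ h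

/-- The registers that an entry is computed from. -/
def entryEnv (n j b : ℤ) (q : ℕ) : ℤ := if q = 0 then n else if q = 1 then j else b

/-- The entry at position `j` of the `a`-th set. -/
noncomputable def entry (H : ThreeUniformHypergraph) (a : ℕ) (j : ℤ) : ℤ :=
  (entryExpr a).eval (entryEnv H.n j (tensor H j))

lemma entry_position (H : ThreeUniformHypergraph) (a : ℕ) (x y z : Fin H.n) :
    entry H a (position H.n x y z) =
      value H.n a x y z (tensor H (position H.n x y z)) := by
  simp only [entry, eval_entryExpr, entryEnv, if_true, one_ne_zero, if_false, OfNat.ofNat_ne_zero,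
    OfNat.ofNat_ne_one, position_div (fin_bounds y) (fin_bounds z),
    position_div_mod (fin_bounds y) (fin_bounds z), position_mod (fin_bounds z)]

/-- A common bound for the degrees of all entries. -/
def degBound : ℕ :=
  (entryExpr 0).deg 3 + (entryExpr 1).deg 3 + (entryExpr 2).deg 3 + (entryExpr 3).deg 3 + 3

lemma deg_le_degBound {a : ℕ} (ha : a < 4) : (entryExpr a).deg 3 ≤ degBound := by
  unfold degBound
  interval_cases a <;> omega

/-- Source of the exponent 3 in `deg 3`: the largest register content is a position below `n ^ 3`.
-/
lemma abs_entryEnv_le {n : ℤ} (hn : 2 ≤ n) {j b : ℤ} (hj : 0 ≤ j ∧ j < n ^ 3)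
    (hb : b = 0 ∨ b = 1) : ∀ q < 3, |entryEnv n j b q| ≤ n ^ 3 := by
  intro q hq
  have h1 : n ≤ n ^ 3 := le_self_pow₀ (by omega) (by norm_num)
  rw [abs_le]
  interval_cases q <;> simp [entryEnv] <;> omega

/-- The `4`-SUM instance that belongs to a hypergraph. -/
noncomputable def toKSum (H : ThreeUniformHypergraph) (hn : 2 ≤ H.n) :
    KSumInstance 4 degBound where
  -- Triples that are not hyperedges also get a number, so all four sets have exactly the same size.
  n := H.n ^ 3
  A := fun i j => entry H i (j : ℕ)
  injective := by
    intro i j j' h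
    have hj : ((j : ℕ) : ℤ) < (H.n : ℤ) ^ 3 := by exact_mod_cast j.2
    have hj' : ((j' : ℕ) : ℤ) < (H.n : ℤ) ^ 3 := by exact_mod_cast j'.2
    obtain ⟨x, y, z, e⟩ := exists_position (by positivity) hj
    obtain ⟨x', y', z', e'⟩ := exists_position (by positivity) hj'
    simp only [e, e', entry_position] at h
    obtain ⟨h1, h2, h3⟩ := value_injective (by exact_mod_cast hn) i.2 (fin_bounds x) (fin_bounds y)
      (fin_bounds z) (fin_bounds x') (fin_bounds y') (fin_bounds z') (tensor_eq_zero_or_one _ _)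
      (tensor_eq_zero_or_one _ _) h
    rw [h1, h2, h3, ← e'] at e
    exact Fin.ext (by exact_mod_cast e)
  bounded := by
    intro i j
    have hn' : (2 : ℤ) ≤ H.n := by exact_mod_cast hn
    have hj : ((j : ℕ) : ℤ) < (H.n : ℤ) ^ 3 := by exact_mod_cast j.2
    refine (Expr.abs_eval_le hn' (abs_entryEnv_le hn' ⟨by positivity, hj⟩
      (tensor_eq_zero_or_one H _)) _ (simple_entryExpr i)).trans ?_
    push_cast
    rw [← pow_mul]
    exact pow_le_pow_right₀ (by omega) ((deg_le_degBound i.2).trans (by omega))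

lemma exists_fin_position {n : ℕ} (j : Fin (n ^ 3)) :
    ∃ x y z : Fin n, ((j : ℕ) : ℤ) = position n x y z :=
  exists_position (by positivity) (by exact_mod_cast j.2)

lemma card_triple_eq_three_iff {α : Type*} [DecidableEq α] {x y z : α} :
    ({x, y, z} : Finset α).card = 3 ↔ x ≠ y ∧ x ≠ z ∧ y ≠ z := by
  constructor
  · intro h
    refine ⟨?_, ?_, ?_⟩ <;> rintro rfl
    · have := Finset.card_le_two (a := x) (b := z)
      simp at h; omega
    · have := Finset.card_le_two (a := x) (b := y)
      rw [Finset.pair_comm y x, Finset.insert_idem] at h; omega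
    · have := Finset.card_le_two (a := x) (b := y)
      simp at h; omega
  · rintro ⟨h1, h2, h3⟩
    exact Finset.card_eq_three.2 ⟨x, y, z, h1, h2, h3, rfl⟩

/-- Uniformity makes the four vertices distinct. A three-element subset omits exactly one of them,
hence is one of the four given hyperedges. -/
lemma hyperclique_of_edges (H : ThreeUniformHypergraph) {v₀ v₁ v₂ v₃ : Fin H.n}
    (h₀ : {v₁, v₂, v₃} ∈ H.edges) (h₁ : {v₂, v₃, v₀} ∈ H.edges) (h₂ : {v₃, v₀, v₁} ∈ H.edges)
    (h₃ : {v₀, v₁, v₂} ∈ H.edges) : ∃ S : Finset (Fin H.n), S.card = 4 ∧ H.IsHyperclique S := by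
  have ne : ∀ {x y z : Fin H.n}, {x, y, z} ∈ H.edges → x ≠ y ∧ x ≠ z ∧ y ≠ z := fun h =>
    card_triple_eq_three_iff.1 (H.uniform _ h)
  obtain ⟨n12, n13, n23⟩ := ne h₀
  obtain ⟨-, n20, n30⟩ := ne h₁
  obtain ⟨-, -, n01⟩ := ne h₂
  have hS : ({v₀, v₁, v₂, v₃} : Finset (Fin H.n)).card = 4 := by
    rw [Finset.card_insert_of_notMem (by simp [n01, n20.symm, n30.symm]), H.uniform _ h₀]
  refine ⟨_, hS, ?_⟩
  intro e he hc
  have h1 : (({v₀, v₁, v₂, v₃} : Finset (Fin H.n)) \ e).card = 1 := by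
    rw [Finset.card_sdiff_of_subset he, hS, hc]
  obtain ⟨v, hv⟩ := Finset.card_eq_one.1 h1
  have he' : e = ({v₀, v₁, v₂, v₃} : Finset (Fin H.n)) \ {v} := by
    rw [← hv, Finset.sdiff_sdiff_eq_self he]
  have hvS : v ∈ ({v₀, v₁, v₂, v₃} : Finset (Fin H.n)) := by
    have : v ∈ ({v₀, v₁, v₂, v₃} : Finset (Fin H.n)) \ e := by rw [hv]; simp
    exact (Finset.mem_sdiff.1 this).1
  simp only [Finset.mem_insert, Finset.mem_singleton] at hvS
  have conv : ∀ {f : Finset (Fin H.n)}, f ∈ H.edges → e = f → e ∈ H.edges := fun h h' => h' ▸ h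
  rcases hvS with rfl | rfl | rfl | rfl
  · refine conv h₀ (he'.trans ?_)
    ext u; simp only [Finset.mem_sdiff, Finset.mem_insert, Finset.mem_singleton]; grind
  · refine conv h₁ (he'.trans ?_)
    ext u; simp only [Finset.mem_sdiff, Finset.mem_insert, Finset.mem_singleton]; grind
  · refine conv h₂ (he'.trans ?_)
    ext u; simp only [Finset.mem_sdiff, Finset.mem_insert, Finset.mem_singleton]; grind
  · refine conv h₃ (he'.trans ?_)
    ext u; simp only [Finset.mem_sdiff, Finset.mem_insert, Finset.mem_singleton]; grind

lemma yes_toKSum_iff (H : ThreeUniformHypergraph) (hn : 2 ≤ H.n) :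
    (kSum 4 degBound).yes (toKSum H hn) ↔ (hypercliqueDetection 4).yes H := by
  have hn' : (2 : ℤ) ≤ H.n := by exact_mod_cast hn
  change (∃ j : Fin 4 → Fin (H.n ^ 3), ∑ i : Fin 4, entry H i (j i : ℕ) = 0) ↔
    ∃ S : Finset (Fin H.n), S.card = 4 ∧ H.IsHyperclique S
  constructor
  · rintro ⟨j, hj⟩
    choose x y z e using fun i => exists_fin_position (j i)
    simp only [e, entry_position, Fin.sum_univ_four] at hj
    have key := eq_of_sum_value_eq_zero hn'
      (x := fun i => ((x (Fin.ofNat 4 i) : ℕ) : ℤ)) (y := fun i => ((y (Fin.ofNat 4 i) : ℕ) : ℤ))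
      (z := fun i => ((z (Fin.ofNat 4 i) : ℕ) : ℤ))
      (b := fun i => tensor H (position H.n (x (Fin.ofNat 4 i)) (y (Fin.ofNat 4 i))
        (z (Fin.ofNat 4 i))))
      (fun i => fin_bounds _) (fun i => fin_bounds _) (fun i => fin_bounds _)
      (fun i => tensor_eq_zero_or_one _ _) hj
    simp only [tensor_position] at key
    obtain ⟨⟨k0, k1, k2, k3⟩, ⟨a1, a2⟩, ⟨b1, b2⟩, ⟨c1, c2⟩, d1, d2⟩ := key
    have cv : ∀ {u v : Fin H.n}, ((u : ℕ) : ℤ) = (v : ℕ) → u = v := fun h =>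
      Fin.ext (by exact_mod_cast h)
    replace a1 := cv a1
    replace a2 := cv a2
    replace b1 := cv b1
    replace b2 := cv b2
    replace c1 := cv c1
    replace c2 := cv c2
    replace d1 := cv d1
    replace d2 := cv d2
    -- The guess with coefficient -2 represents its vertex: `z (i + 1)` stands for the vertex `i`,
    -- and the other two guesses are rewritten to it.
    rw [b1, c2] at k0
    rw [c1, d2] at k1
    rw [d1, a2] at k2
    rw [a1, b2] at k3
    exact hyperclique_of_edges H (v₀ := z (Fin.ofNat 4 1)) (v₁ := z (Fin.ofNat 4 2))
      (v₂ := z (Fin.ofNat 4 3)) (v₃ := z (Fin.ofNat 4 0)) k0 k1 k2 k3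
  · rintro ⟨S, hS, hc⟩
    let v : ℕ → Fin H.n := fun i => S.orderEmbOfFin hS (Fin.ofNat 4 i)
    have ht : ∀ a b c : ℕ, Fin.ofNat 4 a ≠ Fin.ofNat 4 b → Fin.ofNat 4 a ≠ Fin.ofNat 4 c →
        Fin.ofNat 4 b ≠ Fin.ofNat 4 c → tensor H (position H.n (v a) (v b) (v c)) = 1 := by
      intro a b c hab hac hbc
      rw [tensor_position]
      refine hc _ ?_ (card_triple_eq_three_iff.2
        ⟨(S.orderEmbOfFin hS).injective.ne hab, (S.orderEmbOfFin hS).injective.ne hac,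
          (S.orderEmbOfFin hS).injective.ne hbc⟩)
      intro u hu
      simp only [Finset.mem_insert, Finset.mem_singleton] at hu
      rcases hu with rfl | rfl | rfl <;> exact Finset.orderEmbOfFin_mem _ _ _
    have hpos : ∀ a b c : ℕ, ∃ j : Fin (H.n ^ 3), ((j : ℕ) : ℤ) =
        position H.n (v a) (v b) (v c) := by
      intro a b c
      obtain ⟨h0, h1⟩ := position_bounds (v a) (v b) (v c)
      lift position H.n (v a) (v b) (v c) to ℕ using h0 with m
      exact ⟨⟨m, by exact_mod_cast h1⟩, rfl⟩
    obtain ⟨j0, e0⟩ := hpos 1 2 3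
    obtain ⟨j1, e1⟩ := hpos 2 3 0
    obtain ⟨j2, e2⟩ := hpos 3 0 1
    obtain ⟨j3, e3⟩ := hpos 0 1 2
    refine ⟨![j0, j1, j2, j3], ?_⟩
    rw [Fin.sum_univ_four]
    change entry H 0 (j0 : ℕ) + entry H 1 (j1 : ℕ) + entry H 2 (j2 : ℕ) + entry H 3 (j3 : ℕ) = 0
    rw [e0, e1, e2, e3]
    simp only [entry_position]
    rw [ht 1 2 3 (by decide) (by decide) (by decide), ht 2 3 0 (by decide) (by decide) (by decide),
      ht 3 0 1 (by decide) (by decide) (by decide), ht 0 1 2 (by decide) (by decide) (by decide)]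
    exact sum_value_eq_zero H.n fun i => ((v i : ℕ) : ℤ)

end HypercliqueToKSum

/-! ### The program that writes the instance -/

namespace HypercliqueToKSum

open WordRAM

/-- An upper bound for the number of registers used. -/
def regBound : ℕ :=
  3 + (entryExpr 0).size + (entryExpr 1).size + (entryExpr 2).size + (entryExpr 3).size

lemma size_le_regBound {a : ℕ} (ha : a < 4) : 3 + (entryExpr a).size ≤ regBound := by
  unfold regBound
  interval_cases a <;> omega

/-- Write the current entry of the `a`-th set. -/
def writeEntry (a : ℕ) : Prog :=
  .seq ((entryExpr a).compile 3) (.store a (.reg 1) (.reg 3))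

/-- Scratch space starts at register 3, so `n`, the position and the tensor bit survive for the next
set, even after array `0` has been overwritten. -/
lemma exec_writeEntry {w a : ℕ} (ha : a < 4) {H : ThreeUniformHypergraph} (hn : 2 ≤ H.n)
    (hw : ∀ z : ℤ, |z| ≤ (H.n : ℤ) ^ degBound → Fits w z) {j : ℤ} (hj : 0 ≤ j ∧ j < (H.n : ℤ) ^ 3)
    (s : State) (h0 : s.reg 0 = H.n) (h1 : s.reg 1 = j) (h2 : s.reg 2 = tensor H j) :
    ∃ u, Exec w (writeEntry a) s u ((entryExpr a).size + 1) ∧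
      u.mem = Function.update s.mem a (Function.update (s.mem a) j (entry H a j)) ∧
      (∀ q < 3, u.reg q = s.reg q) ∧ ∀ q, regBound ≤ q → u.reg q = s.reg q := by
  have hn' : (2 : ℤ) ≤ H.n := by exact_mod_cast hn
  have henv : ∀ q < 3, s.reg q = entryEnv H.n j (tensor H j) q := by
    intro q hq
    interval_cases q <;> simp [entryEnv, h0, h1, h2]
  have hreg : ∀ q < 3, |s.reg q| ≤ (H.n : ℤ) ^ 3 := fun q hq => by
    rw [henv q hq]
    exact abs_entryEnv_le hn' hj (tensor_eq_zero_or_one H j) q hq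
  have hle : (H.n : ℤ) ^ 3 ≤ (H.n : ℤ) ^ degBound :=
    pow_le_pow_right₀ (by omega) (by unfold degBound; omega)
  obtain ⟨u, hu, um, ur, ul, ug⟩ := Expr.exec_compile (entryExpr a) 3 s le_rfl (simple_entryExpr a)
    (Expr.ok_of_simple hn' hreg hw _ (simple_entryExpr a) (deg_le_degBound ha))
  have hv : u.reg 3 = entry H a j := by
    rw [ur, entry, Expr.eval_congr henv _ (simple_entryExpr a)]
  have hst := Exec.store (w := w) u a (.reg 1) (.reg 3)
    (by
      simp only [Operand.eval]
      rw [ul 1 (by omega)]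
      exact hw _ ((hreg 1 (by omega)).trans hle))
    (by
      simp only [Operand.eval]
      rw [ur]
      exact hw _ ((Expr.abs_eval_le hn' hreg _ (simple_entryExpr a)).trans
        (pow_le_pow_right₀ (by omega) (deg_le_degBound ha))))
  refine ⟨_, hu.seq hst, ?_, ul, fun q hq => ug q ((size_le_regBound ha).trans hq)⟩
  simp [State.setMem, Operand.eval, um, hv, ul 1 (by omega), h1]

/-- One round of the main loop: write the entries at the next position. -/
def round : Prog :=
  .seq (.op 1 .sub (.reg 1) (.const 1))
    (.seq (.load 2 0 (.reg 1))
      (.seq (writeEntry 0) (.seq (writeEntry 1) (.seq (writeEntry 2) (writeEntry 3)))))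

/-- The memory when the positions from `m` on have been treated. -/
noncomputable def memAt (H : ThreeUniformHypergraph) (m : ℤ) (a : ℕ) (j : ℤ) : ℤ :=
  if a < 4 ∧ m ≤ j ∧ j < (H.n : ℤ) ^ 3 then entry H a j
  else ((hypercliqueDetection 4).init H).mem a j

/-- Array `0` holds the tensor and becomes the first set. Working in place is safe because a round
touches only position `j` and loads the bit there before overwriting it. -/
lemma exec_round {w : ℕ} {H : ThreeUniformHypergraph} (hn : 2 ≤ H.n)
    (hw : ∀ z : ℤ, |z| ≤ (H.n : ℤ) ^ degBound → Fits w z) {j : ℤ} (hj : 0 ≤ j ∧ j < (H.n : ℤ) ^ 3)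
    (s : State) (h0 : s.reg 0 = H.n) (h1 : s.reg 1 = j + 1) (hm : s.mem = memAt H (j + 1)) :
    ∃ u, Exec w round s u (regBound + 3) ∧ u.mem = memAt H j ∧ u.reg 0 = H.n ∧ u.reg 1 = j ∧
      ∀ q, regBound ≤ q → u.reg q = s.reg q := by
  have hn' : (2 : ℤ) ≤ H.n := by exact_mod_cast hn
  have h3 : 3 ≤ regBound := by unfold regBound; omega
  have hle : (H.n : ℤ) ^ 3 ≤ (H.n : ℤ) ^ degBound :=
    pow_le_pow_right₀ (by omega) (by unfold degBound; omega)
  have hjw : Fits w j := hw _ (by rw [abs_of_nonneg hj.1]; omega)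
  have hop := Exec.op (w := w) s 1 .sub (.reg 1) (.const 1)
    (by simpa [Op.eval, Operand.eval, h1] using hjw)
  have e1 : Op.sub.eval ((Operand.reg 1).eval s) ((Operand.const 1).eval s) = j := by
    simp [Op.eval, Operand.eval, h1]
  rw [e1] at hop
  have ht : s.mem 0 j = tensor H j := by
    rw [hm, memAt, if_neg (by omega), tensor]
  have hb : Fits w (tensor H j) := hw _ (by
    have : (1 : ℤ) ≤ (H.n : ℤ) ^ degBound := one_le_pow₀ (by omega)
    rcases tensor_eq_zero_or_one H j with h | h <;> rw [h] <;> simp <;> omega)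
  have e2 : (Operand.reg 1).eval (s.setReg 1 j) = j := by simp [Operand.eval, State.setReg]
  have e3 : (s.setReg 1 j).mem 0 j = tensor H j := ht
  have hld := Exec.load (w := w) (s.setReg 1 j) 2 0 (.reg 1) (by rwa [e2]) (by rwa [e2, e3])
  rw [e2, e3] at hld
  set v := (s.setReg 1 j).setReg 2 (tensor H j) with hv
  have v0 : v.reg 0 = H.n := by simp [hv, State.setReg, h0]
  have v1 : v.reg 1 = j := by simp [hv, State.setReg]
  have v2 : v.reg 2 = tensor H j := by simp [hv, State.setReg]
  obtain ⟨u₀, x₀, m₀, l₀, g₀⟩ := exec_writeEntry (a := 0) (by omega) hn hw hj v v0 v1 v2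
  obtain ⟨u₁, x₁, m₁, l₁, g₁⟩ := exec_writeEntry (a := 1) (by omega) hn hw hj u₀
    (by rw [l₀ _ (by omega), v0]) (by rw [l₀ _ (by omega), v1]) (by rw [l₀ _ (by omega), v2])
  obtain ⟨u₂, x₂, m₂, l₂, g₂⟩ := exec_writeEntry (a := 2) (by omega) hn hw hj u₁
    (by rw [l₁ _ (by omega), l₀ _ (by omega), v0]) (by rw [l₁ _ (by omega), l₀ _ (by omega), v1])
    (by rw [l₁ _ (by omega), l₀ _ (by omega), v2])
  obtain ⟨u₃, x₃, m₃, l₃, g₃⟩ := exec_writeEntry (a := 3) (by omega) hn hw hj u₂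
    (by rw [l₂ _ (by omega), l₁ _ (by omega), l₀ _ (by omega), v0])
    (by rw [l₂ _ (by omega), l₁ _ (by omega), l₀ _ (by omega), v1])
    (by rw [l₂ _ (by omega), l₁ _ (by omega), l₀ _ (by omega), v2])
  -- Two instructions, four evaluations and four stores: `regBound` also counts steps, its summand 3
  -- included.
  refine ⟨u₃, (hop.seq (hld.seq (x₀.seq (x₁.seq (x₂.seq x₃))))).cast_time
    (by unfold regBound; omega), ?_, ?_, ?_, ?_⟩
  · have vm : v.mem = memAt H (j + 1) := hm
    rw [m₃, m₂, m₁, m₀, vm]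
    funext a i
    by_cases hi : i = j
    · subst hi
      by_cases ha : a < 4
      · interval_cases a <;> simp [Function.update, memAt, hj.2]
      · simp [Function.update, memAt, ha, show a ≠ 0 by omega, show a ≠ 1 by omega,
          show a ≠ 2 by omega, show a ≠ 3 by omega]
    · have hcond : memAt H (j + 1) a i = memAt H j a i := by
        simp only [memAt, show j + 1 ≤ i ↔ j ≤ i by omega]
      rw [← hcond]
      by_cases h3 : a = 3
      · subst h3; simp [hi]
      by_cases h2 : a = 2
      · subst h2; simp [hi]
      by_cases h1 : a = 1
      · subst h1; simp [hi]
      by_cases h0 : a = 0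
      · subst h0; simp [hi]
      simp [h0, h1, h2, h3]
  · rw [l₃ _ (by omega), l₂ _ (by omega), l₁ _ (by omega), l₀ _ (by omega), v0]
  · rw [l₃ _ (by omega), l₂ _ (by omega), l₁ _ (by omega), l₀ _ (by omega), v1]
  · intro q hq
    rw [g₃ q hq, g₂ q hq, g₁ q hq, g₀ q hq]
    simp [hv, State.setReg, show q ≠ 1 by omega, show q ≠ 2 by omega]

/-- Counting down lets register `1` be both the position counter and the loop condition. Each round
costs one further step for the test. -/
lemma exec_rounds {w : ℕ} {H : ThreeUniformHypergraph} (hn : 2 ≤ H.n)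
    (hw : ∀ z : ℤ, |z| ≤ (H.n : ℤ) ^ degBound → Fits w z) :
    ∀ (m : ℕ) (s : State), m ≤ H.n ^ 3 → s.reg 0 = H.n → s.reg 1 = m → s.mem = memAt H m →
      ∃ u, Exec w (.loop (.reg 1) round) s u (m * (regBound + 4) + 1) ∧ u.mem = memAt H 0 ∧
        u.reg 0 = H.n ∧ ∀ q, regBound ≤ q → u.reg q = s.reg q
  | 0, s, _, h0, h1, h2 =>
      ⟨s, (Exec.loop_stop (by simpa [Operand.eval] using h1)).cast_time (by omega),
        by simpa using h2, h0, fun _ _ => rfl⟩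
  | m + 1, s, hm, h0, h1, h2 => by
      have hm' : (m : ℤ) + 1 ≤ (H.n : ℤ) ^ 3 := by exact_mod_cast hm
      push_cast at h1 h2
      obtain ⟨u, hu, um, u0, u1, ug⟩ := exec_round hn hw (j := m) ⟨by positivity, by omega⟩ s h0 h1 h2
      obtain ⟨v, hv, vm, v0, vg⟩ := exec_rounds hn hw m u (by omega) u0 u1 um
      refine ⟨v, (Exec.loop_step ?_ hu hv).cast_time (by ring), vm, v0, fun q hq => ?_⟩
      · simp only [Operand.eval, h1]; omega
      · rw [vg q hq, ug q hq]

/-- Turn the input into the `4`-SUM instance. -/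
def reduce : Prog :=
  .seq (.op 1 .mul (.reg 0) (.reg 0))
    (.seq (.op 1 .mul (.reg 1) (.reg 0))
      (.seq (.loop (.reg 1) round)
        (.seq (.op 2 .mul (.reg 0) (.reg 0))
          (.seq (.op 0 .mul (.reg 2) (.reg 0)) (clear regBound)))))

/-- The tensor occupies only positions below `n ^ 3` of array `0`, so no trace of it remains outside
the overwritten cells. -/
lemma memAt_zero (H : ThreeUniformHypergraph) (hn : 2 ≤ H.n) :
    memAt H 0 = ((kSum 4 degBound).init (toKSum H hn)).mem := by
  funext a j
  have hN : ((H.n ^ 3 : ℕ) : ℤ) = (H.n : ℤ) ^ 3 := by push_cast; rfl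
  by_cases h : a < 4 ∧ 0 ≤ j ∧ j < (H.n : ℤ) ^ 3
  · have h' : a < 4 ∧ 0 ≤ j ∧ j.toNat < H.n ^ 3 := ⟨h.1, h.2.1, by omega⟩
    rw [memAt, if_pos h]
    refine Eq.trans ?_ (dif_pos h').symm
    change entry H a j = entry H a (j.toNat : ℕ)
    rw [Int.toNat_of_nonneg h.2.1]
  · have h' : ¬ (a < 4 ∧ 0 ≤ j ∧ j.toNat < H.n ^ 3) := fun h2 => h ⟨h2.1, h2.2.1, by omega⟩
    rw [memAt, if_neg h]
    refine Eq.trans ?_ (dif_neg h').symm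
    refine if_neg ?_
    rintro ⟨rfl, x, y, z, rfl, -⟩
    exact h ⟨by omega, position_bounds x y z⟩

lemma exec_mul {w : ℕ} {s : State} {r x y : ℕ} {X Y : ℤ} (hx : s.reg x = X) (hy : s.reg y = Y)
    (hf : Fits w (X * Y)) : Exec w (.op r .mul (.reg x) (.reg y)) s (s.setReg r (X * Y)) 1 := by
  subst hx hy
  exact .op s r .mul (.reg x) (.reg y) hf

/-- The final state has to equal the encoded instance exactly, since the 4-SUM program is only known
to work from there; hence the clearing of registers. Register `1` is unconstrained at the start
because `solve` has used it for its test. -/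
lemma exec_reduce {w : ℕ} {H : ThreeUniformHypergraph} (hn : 2 ≤ H.n)
    (hw : ∀ z : ℤ, |z| ≤ (H.n : ℤ) ^ degBound → Fits w z) (s : State) (h0 : s.reg 0 = H.n)
    (hr : ∀ q, 2 ≤ q → s.reg q = 0) (hm : s.mem = ((hypercliqueDetection 4).init H).mem) :
    Exec w reduce s ((kSum 4 degBound).init (toKSum H hn))
      (H.n ^ 3 * (regBound + 4) + regBound + 6) := by
  have hn' : (2 : ℤ) ≤ H.n := by exact_mod_cast hn
  have hle : (H.n : ℤ) ^ 3 ≤ (H.n : ℤ) ^ degBound :=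
    pow_le_pow_right₀ (by omega) (by unfold degBound; omega)
  have h3 : 3 ≤ regBound := by unfold regBound; omega
  have f3 : Fits w (H.n * H.n * H.n) := hw _ (by
    rw [abs_of_nonneg (by positivity)]; linarith [show (H.n : ℤ) * H.n * H.n = H.n ^ 3 by ring])
  have f2 : Fits w (H.n * H.n) := hw _ (by
    rw [abs_of_nonneg (by positivity)]
    nlinarith [show (H.n : ℤ) * H.n * H.n = H.n ^ 3 by ring])
  have s1 := exec_mul (r := 1) h0 h0 f2
  have s2 := exec_mul (w := w) (s := s.setReg 1 (H.n * H.n)) (r := 1) (x := 1) (y := 0)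
    (X := H.n * H.n) (Y := H.n) (by simp [State.setReg]) (by simp [State.setReg, h0]) f3
  obtain ⟨u, hu, um, u0, ug⟩ := exec_rounds hn hw (H.n ^ 3)
    ((s.setReg 1 (H.n * H.n)).setReg 1 (H.n * H.n * H.n)) le_rfl (by simp [State.setReg, h0])
    (by simp [State.setReg]; ring)
    -- At `m = n ^ 3` the range of treated positions is empty.
    (by
      funext a j
      push_cast
      rw [memAt, if_neg (by omega), ← hm]; rfl)
  have s3 := exec_mul (r := 2) u0 u0 f2
  have s4 := exec_mul (w := w) (s := u.setReg 2 (H.n * H.n)) (r := 0) (x := 2) (y := 0)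
    (X := H.n * H.n) (Y := H.n) (by simp [State.setReg]) (by simp [State.setReg, u0]) f3
  obtain ⟨v, hv, vm, v0, vl, vg⟩ := exec_clear w
    ((u.setReg 2 (H.n * H.n)).setReg 0 (H.n * H.n * H.n)) regBound
  have hfin : v = (kSum 4 degBound).init (toKSum H hn) := by
    have hmem : v.mem = ((kSum 4 degBound).init (toKSum H hn)).mem :=
      (vm.trans um).trans (memAt_zero H hn)
    have hreg : v.reg = ((kSum 4 degBound).init (toKSum H hn)).reg := by
      funext q
      change v.reg q = if q = 0 then ((H.n ^ 3 : ℕ) : ℤ) else 0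
      split_ifs with hq
      · subst hq
        rw [v0]; simp [State.setReg]; ring
      · by_cases hq' : q ≤ regBound
        · exact vl q (by omega) hq'
        · rw [vg q (by omega)]
          simp [State.setReg, hq, show q ≠ 2 by omega, show q ≠ 1 by omega, ug q (by omega),
            hr q (by omega)]
    cases v
    exact congrArg₂ State.mk hreg hmem
  rw [← hfin]
  exact (s1.seq (s2.seq (hu.seq (s3.seq (s4.seq hv))))).cast_time (by omega)

/-! ### The hyperclique algorithm, its word length and its running time -/

/-- Decide whether there is a hyperclique with four vertices by means of a program for `4`-SUM. -/
def solve (p : Prog) : Prog :=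
  .seq (.op 1 .lt (.const 1) (.reg 0))
    (.ite (.reg 1) (.seq reduce p) (.op 0 .add (.const 0) (.const 0)))

lemma exec_solve {w w' : ℕ} (hw1 : 1 ≤ w) (hww : w' ≤ w) {p : Prog} {H : ThreeUniformHypergraph}
    (hn : 2 ≤ H.n) (hw : ∀ z : ℤ, |z| ≤ (H.n : ℤ) ^ degBound → Fits w z) {u : State} {t : ℕ}
    (hp : Exec w' p ((kSum 4 degBound).init (toKSum H hn)) u t) :
    Exec w (solve p) ((hypercliqueDetection 4).init H) u
      (H.n ^ 3 * (regBound + 4) + regBound + 8 + t) := by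
  set s := (hypercliqueDetection 4).init H with hs
  have s0 : s.reg 0 = H.n := rfl
  have sr : ∀ q, q ≠ 0 → s.reg q = 0 := fun q hq => if_neg hq
  have e1 : Op.lt.eval ((Operand.const 1).eval s) ((Operand.reg 0).eval s) = 1 := by
    simp only [Op.eval, Operand.eval, s0]
    exact if_pos (by exact_mod_cast hn)
  have h1 := Exec.op (w := w) s 1 .lt (.const 1) (.reg 0)
    (by rw [e1, Fits, abs_one]; exact one_lt_pow₀ (by norm_num) (by omega))
  rw [e1] at h1
  have h2 := exec_reduce hn hw (s.setReg 1 1) (by simp [State.setReg, s0])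
    (fun q hq => by simp [State.setReg, show q ≠ 1 by omega, sr q (by omega)]) rfl
  exact (h1.seq (.ite_true (by simp [Operand.eval, State.setReg]) (h2.seq (hp.mono hww)))).cast_time
    (by omega)

lemma exec_solve_of_lt_two (w : ℕ) (p : Prog) {H : ThreeUniformHypergraph} (hn : H.n < 2) :
    ∃ u, Exec w (solve p) ((hypercliqueDetection 4).init H) u 3 ∧ u.reg 0 = 0 := by
  set s := (hypercliqueDetection 4).init H with hs
  have s0 : s.reg 0 = H.n := rfl
  have e1 : Op.lt.eval ((Operand.const 1).eval s) ((Operand.reg 0).eval s) = 0 := by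
    simp only [Op.eval, Operand.eval, s0]
    exact if_neg (by omega)
  have h1 := Exec.op (w := w) s 1 .lt (.const 1) (.reg 0) (by rw [e1]; simp [Fits])
  rw [e1] at h1
  exact ⟨_, h1.seq (.ite_false (by simp [Operand.eval, State.setReg])
    (.op _ 0 .add _ _ (by simp [Op.eval, Operand.eval, Fits]))),
    by simp [State.setReg, Op.eval, Operand.eval]⟩

lemma not_yes_of_lt_two {H : ThreeUniformHypergraph} (hn : H.n < 2) :
    ¬ (hypercliqueDetection 4).yes H := by
  rintro ⟨S, hS, -⟩
  have := S.card_le_univ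
  simp at this
  omega

lemma fits_of_abs_le {n d K : ℕ} (hd : K ≤ d) (z : ℤ) (hz : |z| ≤ (n : ℤ) ^ K) (hK : K ≠ 0) :
    Fits (d * (Nat.log 2 n + 1)) z := by
  refine hz.trans_lt ?_
  have h1 : n < 2 ^ (Nat.log 2 n + 1) := Nat.lt_pow_succ_log_self (by norm_num) n
  calc (n : ℤ) ^ K < (2 ^ (Nat.log 2 n + 1)) ^ K :=
        pow_lt_pow_left₀ (by exact_mod_cast h1) (by positivity) hK
    _ = 2 ^ ((Nat.log 2 n + 1) * K) := (pow_mul _ _ _).symm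
    _ ≤ 2 ^ (d * (Nat.log 2 n + 1)) := pow_le_pow_right₀ (by norm_num) (by nlinarith)

lemma log_pow_three_le (n : ℕ) : Nat.log 2 (n ^ 3) + 1 ≤ 3 * (Nat.log 2 n + 1) := by
  rcases Nat.eq_zero_or_pos n with rfl | h
  · simp
  · have h1 : n < 2 ^ (Nat.log 2 n + 1) := Nat.lt_pow_succ_log_self (by norm_num) n
    refine Nat.log_lt_of_lt_pow (by positivity) ?_
    rw [mul_comm, pow_mul]
    exact Nat.pow_lt_pow_left h1 (by norm_num)

/-- Substituting n³ turns the exponent 4/3 - ε into 4 - 3ε. The minimum with 1 leaves room for the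
cubic cost of the reduction. -/
lemma isBigO_time {ε : ℝ} {T : ℕ → ℕ}
    (hT : (fun n => (T n : ℝ)) =O[atTop] fun n : ℕ => (n : ℝ) ^ ((4 : ℝ) / 3 - ε)) (a b : ℕ) :
    (fun n => ((n ^ 3 * a + b + T (n ^ 3) : ℕ) : ℝ)) =O[atTop]
      fun n : ℕ => (n : ℝ) ^ (((4 : ℕ) : ℝ) - min 1 (3 * ε)) := by
  have hmono : ∀ r : ℝ, r ≤ ((4 : ℕ) : ℝ) - min 1 (3 * ε) →
      (fun n : ℕ => (n : ℝ) ^ r) =O[atTop]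
        fun n : ℕ => (n : ℝ) ^ (((4 : ℕ) : ℝ) - min 1 (3 * ε)) := by
    intro r hr
    refine IsBigO.of_bound 1 ?_
    filter_upwards [eventually_ge_atTop 1] with n hn
    have h1 : (1 : ℝ) ≤ n := by exact_mod_cast hn
    rw [Real.norm_of_nonneg (by positivity), Real.norm_of_nonneg (by positivity), one_mul]
    exact Real.rpow_le_rpow_of_exponent_le h1 hr
  have hmin1 := min_le_left (1 : ℝ) (3 * ε)
  have hmin2 := min_le_right (1 : ℝ) (3 * ε)
  have h3 := hmono 3 (by push_cast; linarith)
  have h0 := hmono 0 (by push_cast; linarith)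
  have hcomp := hT.comp_tendsto (tendsto_pow_atTop (α := ℕ) (n := 3) (by norm_num))
  have hlast : (fun n => (T (n ^ 3) : ℝ)) =O[atTop]
      fun n : ℕ => (n : ℝ) ^ (((4 : ℕ) : ℝ) - min 1 (3 * ε)) := by
    refine IsBigO.trans (g := fun n : ℕ => (n : ℝ) ^ (4 - 3 * ε)) ?_
      (hmono _ (by push_cast; linarith))
    refine hcomp.congr_right fun n => ?_
    simp only [Function.comp_apply]
    push_cast
    rw [← Real.rpow_natCast, ← Real.rpow_mul (by positivity)]
    congr 1
    push_cast
    ring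
  have hsum := ((h3.const_mul_left (a : ℝ)).add (h0.const_mul_left (b : ℝ))).add hlast
  refine hsum.congr_left fun n => ?_
  have e3 : (n : ℝ) ^ (3 : ℝ) = (n : ℝ) ^ 3 := by exact_mod_cast Real.rpow_natCast (n : ℝ) 3
  simp only [e3, Real.rpow_zero]
  push_cast
  ring

end HypercliqueToKSum

open WordRAM HypercliqueToKSum in
theorem mainTheorem11 (ε : ℝ) (hε : 0 < ε)
    (h : ∀ c : ℕ, (kSum 4 c).SolvableInTime (fun n => (n : ℝ) ^ ((4 : ℝ) / 3 - ε))) :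
    ¬ ThreeUniformHypercliqueHypothesis := by
  intro hyp
  obtain ⟨p, d, T, hT, hp⟩ := h degBound
  -- The words need `3 * d` because the 4-SUM program runs on size n³, whose logarithm is up to
  -- three times as large, and `degBound` so that the values of the reduction fit.
  refine hyp 4 le_rfl (min 1 (3 * ε)) (by positivity) ⟨solve p, 3 * d + degBound,
    fun n => n ^ 3 * (regBound + 4) + (regBound + 8) + T (n ^ 3), isBigO_time hT _ _, ?_⟩
  intro H
  change ThreeUniformHypergraph at H
  have hdeg : 3 ≤ degBound := by unfold degBound; omega
  by_cases hn : 2 ≤ H.n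
  · obtain ⟨u, t, hu, ht, hy⟩ := hp (toKSum H hn)
    refine ⟨u, _, exec_solve ?_ ?_ hn
      (fun z hz => fits_of_abs_le (by omega) z hz (by omega)) hu, ?_,
      hy.trans (yes_toKSum_iff H hn)⟩
    · exact one_le_mul (by omega) (by omega)
    · have := log_pow_three_le H.n
      change d * (Nat.log 2 (H.n ^ 3) + 1) ≤ (3 * d + degBound) * (Nat.log 2 H.n + 1)
      nlinarith
    · change t ≤ T (H.n ^ 3) at ht
      change _ ≤ H.n ^ 3 * (regBound + 4) + (regBound + 8) + T (H.n ^ 3)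
      omega
  -- With fewer than two vertices the power bounds fail, but there is no hyperclique on four
  -- vertices and `solve` answers 0 directly.
  · obtain ⟨u, hu, h0⟩ := exec_solve_of_lt_two ((3 * d + degBound) * (Nat.log 2 H.n + 1)) p
      (not_le.1 hn)
    refine ⟨u, 3, hu, ?_, ?_⟩
    · change 3 ≤ H.n ^ 3 * (regBound + 4) + (regBound + 8) + T (H.n ^ 3)
      omega
    · exact iff_of_false (by simp [h0]) (not_yes_of_lt_two (not_le.1 hn))
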